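/- A coherent 2-group is a (small) monoidal category $C$, with unit object $1$, associator $a$ and unit laws $\ell, r$, in which every morphism is invertible and every object $x$ is equipped with an object $\bar x$ and isomorphisms $i_x\colon 1\to x\otimes\bar x$, $e_x\colon \bar x\otimes x\to 1$ satisfying the two zig-zag identities. Let $\mathrm{C2G}$ be the 2-category whose objects are coherent 2-groups, whose morphisms are weak (i.e. strong) monoidal functors and whose 2-morphisms are monoidal natural transformations. Two coherent 2-groups are equivalent if they are equivalent objects of $\mathrm{C2G}$. Consider quadruples $(G,H,\alpha,[a])$ consisting of a group $G$, an abelian group $H$, an action $\alpha$ of $G$ as automorphisms of $H$, and an element $[a]$ of the cohomology group $H^3(G,H)$ of $G$ with coefficients in the $G$-module $H$. An isomorphism from $(G,H,\alpha,[a])$ to $(G',H',\alpha',[a'])$ consists of an isomorphism $G\to G'$ and an isomorphism $H\to H'$, carrying $\alpha$ to $\alpha'$ and $[a]$ to $[a']$. There is a one-to-one correspondence between equivalence classes of coherent 2-groups and isomorphism classes of such quadruples. More precisely, there is a bijection under which the class of a coherent 2-group $C$ corresponds to the class of $(G,H,\alpha,c)$ if and only if there are - objects $s(g)\in C$ for $g\in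 G$ such that every object of $C$ is isomorphic to $s(g)$ for exactly one $g$, - isomorphisms $m_{g,g'}\colon s(g)\otimes s(g')\to s(gg')$ for all $g,g'\in G$, - an isomorphism of groups $H\cong\mathrm{Aut}(1)$, and - a 3-cocycle $a\colon G^3\to H$ representing $c$, such that, if for an automorphism $f$ of an object $x$ we write $\langle f\rangle = i_x\,(f\otimes 1_{\bar x})\,i_x^{-1}\in \mathrm{Aut}(1)$ (composites in diagrammatic order) and identify $H$ with $\mathrm{Aut}(1)$, one has $$\alpha(g,h)=\langle r_{s(g)}^{-1}\,(1_{s(g)}\otimes h)\,r_{s(g)}\rangle\quad (g\in G,\ h\in H),$$ $$a(g_1,g_2,g_3)=\langle m_{g_1g_2,g_3}^{-1}\,(m_{g_1,g_2}^{-1}\otimes 1)\,a_{s(g_1),s(g_2),s(g_3)}\,(1\otimes m_{g_2,g_3})\,m_{g_1,g_2g_3}\rangle\quad (g_1,g_2,g_3\in G).$$ -/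

import Mathlib

open CategoryTheory MonoidalCategory

universe u

/-! ## Coherent 2-groups -/

/-- A (small) coherent 2-group: a monoidal category in which every morphism is invertible and every
object `x` is equipped with a specified adjoint equivalence `(x, bar x, i_x, e_x)`. Here
`ExactPairing x (bar x)` consists of the unit `i_x : 𝟙_ ⟶ x ⊗ bar x` (Mathlib: coevaluation) and
the counit `e_x : bar x ⊗ x ⟶ 𝟙_` (Mathlib: evaluation), subject to both zig-zag identities; the
unit and the counit are invertible because all morphisms are. -/
structure Coherent2Group where
  /-- the objects -/
  carrier : Type u
  [category : SmallCategory carrier]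
  [monoidal : MonoidalCategory carrier]
  [groupoid : IsGroupoid carrier]
  /-- the specified weak inverse of an object -/
  bar : carrier → carrier
  /-- the specified adjunction -/
  adj : ∀ x : carrier, ExactPairing x (bar x)

namespace Coherent2Group

instance : CoeSort Coherent2Group.{u} (Type u) := ⟨Coherent2Group.carrier⟩

attribute [instance] category monoidal groupoid adj

/-- A homomorphism of coherent 2-groups: a weak (strong) monoidal functor. -/
structure Hom (C D : Coherent2Group.{u}) where
  /-- the underlying functor -/
  functor : C ⥤ D
  [monoidal : functor.Monoidal]

attribute [instance] Hom.monoidal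

/-- A 2-homomorphism: a monoidal natural transformation. -/
@[ext]
structure Hom₂ {C D : Coherent2Group.{u}} (F G : Hom C D) where
  /-- the underlying natural transformation -/
  natTrans : F.functor ⟶ G.functor
  [isMonoidal : NatTrans.IsMonoidal natTrans]

attribute [instance] Hom₂.isMonoidal

instance : CategoryStruct Coherent2Group.{u} where
  Hom := Hom
  id C := { functor := 𝟭 C }
  comp F G := { functor := F.functor ⋙ G.functor }

instance (C D : Coherent2Group.{u}) : Category (C ⟶ D) where
  Hom F G := Hom₂ F G
  id F := { natTrans := 𝟙 F.functor }
  comp θ τ := { natTrans := θ.natTrans ≫ τ.natTrans }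
  id_comp _ := Hom₂.ext (Category.id_comp _)
  comp_id _ := Hom₂.ext (Category.comp_id _)
  assoc _ _ _ := Hom₂.ext (Category.assoc _ _ _)

/-- An invertible monoidal natural transformation is an invertible 2-homomorphism. -/
def isoMk {C D : Coherent2Group.{u}} {F G : C ⟶ D} (e : F.functor ≅ G.functor)
    [NatTrans.IsMonoidal e.hom] : F ≅ G where
  hom := Hom₂.mk e.hom
  inv := Hom₂.mk e.inv
  hom_inv_id := Hom₂.ext e.hom_inv_id
  inv_hom_id := Hom₂.ext e.inv_hom_id

/-- The 2-category `C2G` of coherent 2-groups, homomorphisms and 2-homomorphisms. -/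
instance : Bicategory Coherent2Group.{u} where
  whiskerLeft F _ _ θ := Hom₂.mk (Functor.whiskerLeft F.functor (Hom₂.natTrans θ))
  whiskerRight θ G := Hom₂.mk (Functor.whiskerRight (Hom₂.natTrans θ) G.functor)
  associator F G H := isoMk (Functor.associator F.functor G.functor H.functor)
  leftUnitor {C _} F := @isoMk _ _ (𝟙 C ≫ F) F F.functor.leftUnitor
    (inferInstanceAs (NatTrans.IsMonoidal F.functor.leftUnitor.hom))
  rightUnitor {_ D} F := @isoMk _ _ (F ≫ 𝟙 D) F F.functor.rightUnitor
    (inferInstanceAs (NatTrans.IsMonoidal F.functor.rightUnitor.hom))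
  whiskerLeft_id F G := Hom₂.ext (Functor.whiskerLeft_id' F.functor)
  whiskerLeft_comp F _ _ _ θ τ := Hom₂.ext (Functor.whiskerLeft_comp F.functor _ _)
  id_whiskerLeft θ := Hom₂.ext (NatTrans.ext (funext fun x =>
    ((Category.id_comp _).trans (Category.comp_id ((Hom₂.natTrans θ).app x))).symm))
  comp_whiskerLeft F G _ _ θ := Hom₂.ext (NatTrans.ext (funext fun x =>
    ((Category.id_comp _).trans
      (Category.comp_id ((Hom₂.natTrans θ).app (G.functor.obj (F.functor.obj x))))).symm))
  id_whiskerRight F G := Hom₂.ext (Functor.whiskerRight_id' G.functor)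
  comp_whiskerRight θ τ G := Hom₂.ext (Functor.whiskerRight_comp _ _ G.functor)
  whiskerRight_id θ := Hom₂.ext (NatTrans.ext (funext fun x =>
    ((Category.id_comp _).trans (Category.comp_id ((Hom₂.natTrans θ).app x))).symm))
  whiskerRight_comp θ G H := Hom₂.ext (NatTrans.ext (funext fun x =>
    ((Category.id_comp _).trans
      (Category.comp_id (H.functor.map (G.functor.map ((Hom₂.natTrans θ).app x))))).symm))
  whisker_assoc F _ _ θ H := Hom₂.ext (NatTrans.ext (funext fun x =>
    ((Category.id_comp _).trans
      (Category.comp_id (H.functor.map ((Hom₂.natTrans θ).app (F.functor.obj x))))).symm))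
  whisker_exchange θ τ := Hom₂.ext (NatTrans.ext (funext fun x =>
    ((Hom₂.natTrans τ).naturality ((Hom₂.natTrans θ).app x)).symm))
  pentagon F G H K :=
    Hom₂.ext (Functor.pentagon F.functor G.functor H.functor K.functor)
  triangle F G := Hom₂.ext (Functor.triangle F.functor G.functor)

open Bicategory in
/-- Equivalence of coherent 2-groups as objects of the 2-category `C2G`. -/
def Equivalent (C D : Coherent2Group.{u}) : Prop :=
  ∃ (F : C ⟶ D) (G : D ⟶ C), Nonempty (F ≫ G ≅ 𝟙 C) ∧ Nonempty (G ≫ F ≅ 𝟙 D)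

open Bicategory in
theorem equivalent_equivalence : Equivalence Equivalent.{u} where
  refl C := ⟨𝟙 C, 𝟙 C, ⟨Bicategory.leftUnitor _⟩, ⟨Bicategory.leftUnitor _⟩⟩
  symm := fun ⟨F, G, h, h'⟩ => ⟨G, F, h', h⟩
  trans := by
    rintro C D E ⟨F, G, ⟨a⟩, ⟨b⟩⟩ ⟨F', G', ⟨a'⟩, ⟨b'⟩⟩
    refine ⟨F ≫ F', G' ≫ G, ⟨?_⟩, ⟨?_⟩⟩
    · exact Bicategory.associator F F' (G' ≫ G) ≪≫ whiskerLeftIso F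
        ((Bicategory.associator F' G' G).symm ≪≫ whiskerRightIso a' G ≪≫ Bicategory.leftUnitor G)
        ≪≫ a
    · exact Bicategory.associator G' G (F ≫ F') ≪≫ whiskerLeftIso G'
        ((Bicategory.associator G F F').symm ≪≫ whiskerRightIso b F' ≪≫ Bicategory.leftUnitor F')
        ≪≫ b'

/-- Coherent 2-groups up to equivalence. -/
instance setoid : Setoid Coherent2Group.{u} := ⟨Equivalent, equivalent_equivalence⟩

end Coherent2Group

/-! ## Quadruples -/

/-- An abelian group `H` on which `G` acts by automorphisms, as a representation of `G` over (the
copy in `Type u` of) the ring `ℤ`. -/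
noncomputable abbrev gModule (G H : Type u) [Group G] [AddCommGroup H] [DistribMulAction G H] :
    Rep.{u} (ULift.{u} ℤ) G :=
  haveI : SMulCommClass G (ULift.{u} ℤ) H :=
    ⟨fun g n h => (smul_comm g n.down h : g • (n.down • h) = n.down • (g • h))⟩
  Rep.ofDistribMulAction (ULift.{u} ℤ) G H

/-- A quadruple `(G, H, α, c)`: a group `G`, an abelian group `H` (written additively), an action
`α` of `G` on `H` by automorphisms, and a class `c` in the group cohomology `H³(G, H)`. -/
structure Quadruple where
  /-- the group `G` -/
  G : Type u
  /-- the abelian group `H` -/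
  H : Type u
  [group : Group G]
  [addCommGroup : AddCommGroup H]
  /-- the action `α` -/
  [action : DistribMulAction G H]
  /-- the cohomology class -/
  cls : groupCohomology (gModule G H) 3

namespace Quadruple

attribute [instance] group addCommGroup action

/-- The morphism `res_{φ⁻¹} H ⟶ H'` of `G'`-modules given by an isomorphism of groups
`φ : G ≃* G'` and an isomorphism `ψ : H ≃+ H'` that carries the action `α` to `α'`. -/
noncomputable def moduleHom {G H G' H' : Type u} [Group G] [AddCommGroup H] [Group G']
    [AddCommGroup H'] [DistribMulAction G H] [DistribMulAction G' H'] (φ : G ≃* G') (ψ : H ≃+ H')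
    (hψ : ∀ (g : G) (h : H), ψ (g • h) = φ g • ψ h) :
    Rep.res (φ.symm : G' →* G) (gModule G H) ⟶ gModule G' H' :=
  Rep.ofHom
    { toFun := fun h => ψ h
      map_add' := fun h h' => map_add ψ h h'
      map_smul' := fun n h => map_zsmul ψ n.down h
      isIntertwining' := fun g => by
        ext h
        have := hψ (φ.symm g) h
        rw [MulEquiv.apply_symm_apply] at this
        exact this }

/-- An isomorphism of quadruples: an isomorphism `G ≃ G'` and an isomorphism `H ≃ H'` carrying
`α` to `α'` and the class of the first quadruple to that of the second. -/
structure Iso (Q Q' : Quadruple.{u}) where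
  /-- the isomorphism of groups `G ≃ G'` -/
  φ : Q.G ≃* Q'.G
  /-- the isomorphism of abelian groups `H ≃ H'` -/
  ψ : Q.H ≃+ Q'.H
  map_action : ∀ (g : Q.G) (h : Q.H), ψ (g • h) = φ g • ψ h
  map_cls : groupCohomology.map (φ.symm : Q'.G →* Q.G) (moduleHom φ ψ map_action) 3 Q.cls = Q'.cls

/-- The identity isomorphism. -/
def Iso.refl (Q : Quadruple.{u}) : Iso Q Q where
  φ := MulEquiv.refl _
  ψ := AddEquiv.refl _
  map_action _ _ := rfl
  map_cls := by
    have := groupCohomology.map_id (B := gModule Q.G Q.H) (n := 3)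
    exact congrArg (fun f => f.hom Q.cls) this

/-- Composition of isomorphisms. -/
def Iso.trans {Q Q' Q'' : Quadruple.{u}} (e : Iso Q Q') (f : Iso Q' Q'') : Iso Q Q'' where
  φ := e.φ.trans f.φ
  ψ := e.ψ.trans f.ψ
  map_action g h := by simp [e.map_action, f.map_action]
  map_cls := by
    have := groupCohomology.map_comp (e.φ.symm : Q'.G →* Q.G) (f.φ.symm : Q''.G →* Q'.G)
      (moduleHom e.φ e.ψ e.map_action) (moduleHom f.φ f.ψ f.map_action) 3
    have h := congrArg (fun k => k.hom Q.cls) this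
    refine Eq.trans h ?_
    rw [← f.map_cls, ← e.map_cls]
    rfl

/-- The inverse isomorphism. -/
def Iso.symm {Q Q' : Quadruple.{u}} (e : Iso Q Q') : Iso Q' Q where
  φ := e.φ.symm
  ψ := e.ψ.symm
  map_action g h := by
    apply e.ψ.injective
    simp [e.map_action]
  map_cls := by
    have hact : ∀ (g : Q'.G) (h : Q'.H), e.ψ.symm (g • h) = e.φ.symm g • e.ψ.symm h := fun g h => by
      apply e.ψ.injective
      simp [e.map_action]
    have := groupCohomology.map_comp (e.φ.symm : Q'.G →* Q.G) (e.φ.symm.symm : Q.G →* Q'.G)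
      (moduleHom e.φ e.ψ e.map_action) (moduleHom e.φ.symm e.ψ.symm hact) 3
    have h := congrArg (fun k => k.hom Q.cls) this
    rw [← e.map_cls]
    refine Eq.trans h.symm ?_
    have h2 := groupCohomology.map_id (B := gModule Q.G Q.H) (n := 3)
    refine Eq.trans ?_ (congrArg (fun f => f.hom Q.cls) h2)
    congr 2
    refine groupCohomology.map_congr ?_ ?_ 3
    · ext g; simp
    · ext h; exact e.ψ.symm_apply_apply h

/-- Quadruples up to isomorphism. -/
instance setoid : Setoid Quadruple.{u} where
  r Q Q' := Nonempty (Iso Q Q')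
  iseqv :=
    { refl := fun Q => ⟨Iso.refl Q⟩
      symm := fun ⟨e⟩ => ⟨e.symm⟩
      trans := fun ⟨e⟩ ⟨f⟩ => ⟨e.trans f⟩ }

end Quadruple

/-! ## The quadruple determined by a coherent 2-group -/

namespace Coherent2Group

/-- The identification of the automorphisms of an object `x` with the automorphisms of the unit
object: tensor with `bar x` on the right and use `i_x : 𝟙_ ≅ x ⊗ bar x`. -/
noncomputable def toUnit (C : Coherent2Group.{u}) (x : C) (f : x ⟶ x) : 𝟙_ C ⟶ 𝟙_ C :=
  η_ x (C.bar x) ≫ f ▷ C.bar x ≫ inv (η_ x (C.bar x))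

/-- The data by which a coherent 2-group `C` determines a group `G` (its isomorphism classes of
objects), an abelian group `H` (the automorphisms of its unit object), an action `α` (conjugation)
and a function `a : G³ → H` (the associator, read off on representatives of the isomorphism
classes). If `C` is skeletal with identity unit laws, one may take `rep` and all `mul` to be
identities. -/
structure Coordinates (C : Coherent2Group.{u}) {G H : Type u} [Group G] [AddCommGroup H]
    [DistribMulAction G H] (a : (Fin 3 → G) → H) where
  /-- a representative of each isomorphism class of objects -/
  rep : G → C
  existsUnique_rep : ∀ x : C, ∃! g : G, Nonempty (x ≅ rep g)
  /-- the multiplication of `G` comes from the tensor product -/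
  mul : ∀ g₁ g₂ : G, rep g₁ ⊗ rep g₂ ≅ rep (g₁ * g₂)
  /-- `H` is the group of automorphisms of the unit object -/
  aut : Multiplicative H ≃* Aut (𝟙_ C)
  /-- the action is `α(g, h) = (1_g ⊗ h) ⊗ 1_{bar g}` -/
  action : ∀ (g : G) (h : H), (aut (.ofAdd (g • h))).hom =
    C.toUnit (rep g) ((ρ_ (rep g)).inv ≫ rep g ◁ (aut (.ofAdd h)).hom ≫ (ρ_ (rep g)).hom)
  /-- `a(g₁, g₂, g₃)` is the associator -/
  associator : ∀ g₁ g₂ g₃ : G, (aut (.ofAdd (a ![g₁, g₂, g₃]))).hom =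
    C.toUnit (rep (g₁ * g₂ * g₃))
      ((mul (g₁ * g₂) g₃).inv ≫ (mul g₁ g₂).inv ▷ rep g₃ ≫
        (α_ (rep g₁) (rep g₂) (rep g₃)).hom ≫
        rep g₁ ◁ (mul g₂ g₃).hom ≫ (mul g₁ (g₂ * g₃)).hom ≫
        eqToHom (congrArg rep (mul_assoc g₁ g₂ g₃).symm))

/-- The quadruple `Q = (G, H, α, [a])` is a quadruple of the coherent 2-group `C`: for some 3-cocycle
`a` that represents the cohomology class, `(G, H, α, a)` is read off from `C` as above. -/
def HasQuadruple (C : Coherent2Group.{u}) (Q : Quadruple.{u}) : Prop :=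
  ∃ a : groupCohomology.cocycles (gModule Q.G Q.H) 3,
    groupCohomology.π (gModule Q.G Q.H) 3 a = Q.cls ∧
    Nonempty (C.Coordinates (G := Q.G) (H := Q.H)
      (groupCohomology.iCocycles (gModule Q.G Q.H) 3 a))

end Coherent2Group

/-! ## Monoidal groupoids in which every object is invertible -/

namespace CategoryTheory

section

variable {C : Type*} [Category* C] [MonoidalCategory C]

/-! A coherent 2-group is determined up to equivalence by a skeletal model. A 3-cocycle `a` on `G`
with values in `H` gives a 2-group `skeletal a` with objects `G`, with every automorphism group
equal to `H`, and with associator `a`. Coordinates on `C` with cocycle `a` amount to a monoidal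
equivalence from `skeletal a` to `C` (`Coordinates.equivalent_skeletal`,
`coordinatesOfEquivalence`), so `C` has the quadruple `Q` iff `C` is equivalent to `skeletal a` for
some `a` representing the class of `Q` (`hasQuadruple_iff`).

Coordinates always exist: take isomorphism classes for `G` and `Aut(𝟙_)` for `H`; the pentagon is
the cocycle identity (`Coordinates.cocycle`). A monoidal equivalence between skeletal 2-groups
consists, apart from its unit constraint, of isomorphisms `φ`, `ψ` compatible with the actions and a
2-cochain `b`, the tensor constraint, whose coherence says that the two cocycles, once transported,
differ by the coboundary of `b` (`map_π_eq_π_iff`). Hence skeletal 2-groups are equivalent iff their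
quadruples are isomorphic, and the bijection follows formally.

Two devices keep this short. `Aut(𝟙_)` acts on every object through `unitAct`, naturally and simply
transitively on automorphisms, which removes `bar x` and `i_x` from all equations. And
`nonempty_monoidal` supplies unit constraints, so neither cocycles nor cochains have to be
normalized. -/

lemma isEquivalence_tensorLeft_of_exactPairing [IsGroupoid C] (X Y : C) [ExactPairing X Y] :
    (tensorLeft X).IsEquivalence :=
  (tensorLeftAdjunction X Y).toEquivalence.isEquivalence_inverse

lemma isEquivalence_tensorRight_of_exactPairing [IsGroupoid C] (X Y : C) [ExactPairing X Y] :
    (tensorRight X).IsEquivalence :=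
  (tensorRightAdjunction X Y).toEquivalence.isEquivalence_functor

lemma whiskerLeft_cancel_of_exactPairing [IsGroupoid C] (X Y : C) [ExactPairing X Y]
    {A B : C} {f g : A ⟶ B} (h : X ◁ f = X ◁ g) : f = g :=
  have := isEquivalence_tensorLeft_of_exactPairing X Y
  (tensorLeft X).map_injective h

/-- The action of an endomorphism of the unit object on an object. -/
def unitAct (z : 𝟙_ C ⟶ 𝟙_ C) (X : C) : X ⟶ X := (λ_ X).inv ≫ z ▷ X ≫ (λ_ X).hom

@[simp]
lemma unitAct_id (X : C) : unitAct (𝟙 (𝟙_ C)) X = 𝟙 X := by simp [unitAct]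

lemma unitAct_comp (z w : 𝟙_ C ⟶ 𝟙_ C) (X : C) :
    unitAct (z ≫ w) X = unitAct z X ≫ unitAct w X := by simp [unitAct]

lemma unitAct_naturality (z : 𝟙_ C ⟶ 𝟙_ C) {X Y : C} (f : X ⟶ Y) :
    unitAct z X ≫ f = f ≫ unitAct z Y := by
  simp only [unitAct, Category.assoc, ← leftUnitor_naturality, leftUnitor_inv_naturality_assoc]
  rw [whisker_exchange_assoc]

lemma unitAct_naturality_assoc (z : 𝟙_ C ⟶ 𝟙_ C) {X Y Z : C} (f : X ⟶ Y) (g : Y ⟶ Z) :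
    unitAct z X ≫ f ≫ g = f ≫ unitAct z Y ≫ g := by
  rw [← Category.assoc, unitAct_naturality, Category.assoc]

lemma unitAct_whiskerRight (z : 𝟙_ C ⟶ 𝟙_ C) (X Y : C) :
    unitAct z X ▷ Y = unitAct z (X ⊗ Y) := by
  simp [unitAct]

@[simp]
lemma unitAct_unit (z : 𝟙_ C ⟶ 𝟙_ C) : unitAct z (𝟙_ C) = z := by
  simp [unitAct, unitors_equal, unitors_inv_equal]

/-- The Eckmann–Hilton argument: on the unit object `unitAct z` is `z` itself, so its naturality is
commutativity. -/
lemma unitEnd_comm (z w : 𝟙_ C ⟶ 𝟙_ C) : z ≫ w = w ≫ z := by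
  simpa using unitAct_naturality z w

/-- The triangle identity moves `z` to the left factor, where it becomes the automorphism of `X`
that defines the action of `X` on `Aut(𝟙_)`. -/
lemma whiskerLeft_unitAct (z : 𝟙_ C ⟶ 𝟙_ C) (X Y : C) :
    X ◁ unitAct z Y = ((ρ_ X).inv ≫ X ◁ z ≫ (ρ_ X).hom) ▷ Y := by
  simp [unitAct]

lemma unitAct_injective [IsGroupoid C] (X Y : C) [ExactPairing X Y] {z w : 𝟙_ C ⟶ 𝟙_ C}
    (h : unitAct z X = unitAct w X) : z = w := by
  have := isEquivalence_tensorRight_of_exactPairing X Y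
  refine (tensorRight X).map_injective ?_
  simpa [unitAct] using h

end

section

variable {C D : Type*} [Category* C] [MonoidalCategory C] [Category* D] [MonoidalCategory D]

open Functor.LaxMonoidal Functor.OplaxMonoidal in
lemma map_unitAct (F : C ⥤ D) [F.Monoidal] (z : 𝟙_ C ⟶ 𝟙_ C) (X : C) :
    F.map (unitAct z X) = unitAct (ε F ≫ F.map z ≫ η F) (F.obj X) := by
  simp only [unitAct, Functor.map_comp, Functor.Monoidal.map_leftUnitor_inv,
    Functor.Monoidal.map_whiskerRight, Functor.Monoidal.map_leftUnitor, comp_whiskerRight,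
    Category.assoc, Functor.Monoidal.μ_δ_assoc]

open Functor.LaxMonoidal Functor.OplaxMonoidal in
lemma map_rightUnitor_conj (F : C ⥤ D) [F.Monoidal] (z : 𝟙_ C ⟶ 𝟙_ C) (X : C) :
    F.map ((ρ_ X).inv ≫ X ◁ z ≫ (ρ_ X).hom) =
      (ρ_ (F.obj X)).inv ≫ F.obj X ◁ (ε F ≫ F.map z ≫ η F) ≫ (ρ_ (F.obj X)).hom := by
  simp only [Functor.map_comp, Functor.Monoidal.map_rightUnitor_inv,
    Functor.Monoidal.map_whiskerLeft, Functor.Monoidal.map_rightUnitor,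
    MonoidalCategory.whiskerLeft_comp, Category.assoc, Functor.Monoidal.μ_δ_assoc]

/-- A functor between monoidal groupoids with invertible objects that is compatible with the tensor
products and the associators is monoidal: there is exactly one possible unit isomorphism. -/
lemma nonempty_monoidal [IsGroupoid D] (dual : D → D) [∀ X, ExactPairing X (dual X)] (F : C ⥤ D)
    (μ : ∀ X Y : C, F.obj X ⊗ F.obj Y ≅ F.obj (X ⊗ Y))
    (natural_left : ∀ {X Y : C} (f : X ⟶ Y) (Z : C),
      F.map f ▷ F.obj Z ≫ (μ Y Z).hom = (μ X Z).hom ≫ F.map (f ▷ Z))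
    (natural_right : ∀ {X Y : C} (Z : C) (f : X ⟶ Y),
      F.obj Z ◁ F.map f ≫ (μ Z Y).hom = (μ Z X).hom ≫ F.map (Z ◁ f))
    (associativity : ∀ X Y Z : C,
      (μ X Y).hom ▷ F.obj Z ≫ (μ (X ⊗ Y) Z).hom ≫ F.map (α_ X Y Z).hom =
        (α_ (F.obj X) (F.obj Y) (F.obj Z)).hom ≫ F.obj X ◁ (μ Y Z).hom ≫ (μ X (Y ⊗ Z)).hom) :
    Nonempty F.Monoidal := by
  have := isEquivalence_tensorLeft_of_exactPairing (F.obj (𝟙_ C)) (dual (F.obj (𝟙_ C)))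
  -- The right unit law at `𝟙_` determines `ε`, because tensoring with `F.obj (𝟙_ C)` is fully
  -- faithful. The left law at `X` then follows from associativity at `(𝟙_, 𝟙_, X)`, and the right
  -- law from associativity at `(X, 𝟙_, 𝟙_)` and the left law at `𝟙_`.
  obtain ⟨ε, hε⟩ : ∃ ε : 𝟙_ D ⟶ F.obj (𝟙_ C), F.obj (𝟙_ C) ◁ ε ≫ (μ _ _).hom ≫ F.map (ρ_ _).hom =
      (ρ_ (F.obj (𝟙_ C))).hom := by
    obtain ⟨ε, hε⟩ := (tensorLeft (F.obj (𝟙_ C))).map_surjective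
      ((ρ_ (F.obj (𝟙_ C))).hom ≫ F.map (ρ_ (𝟙_ C)).inv ≫ (μ _ _).inv)
    refine ⟨ε, ?_⟩
    dsimp at hε
    simp [hε, ← F.map_comp]
  have left (X : C) : (λ_ (F.obj X)).hom = ε ▷ F.obj X ≫ (μ (𝟙_ C) X).hom ≫ F.map (λ_ X).hom := by
    apply whiskerLeft_cancel_of_exactPairing (F.obj (𝟙_ C)) (dual (F.obj (𝟙_ C)))
    rw [← cancel_epi (α_ _ _ _).hom, ← cancel_mono (μ _ _).hom]
    have h1 := associativity (𝟙_ C) (𝟙_ C) X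
    have h2 := congr($hε ▷ F.obj X)
    simp only [comp_whiskerRight] at h2
    rw [triangle, ← h2]
    simp only [whiskerLeft_comp, Category.assoc, natural_left, natural_right]
    rw [← associator_naturality_middle_assoc, ← reassoc_of% h1, ← F.map_comp, triangle]
  have right (X : C) : (ρ_ (F.obj X)).hom = F.obj X ◁ ε ≫ (μ X (𝟙_ C)).hom ≫ F.map (ρ_ X).hom := by
    have := isEquivalence_tensorRight_of_exactPairing (F.obj (𝟙_ C)) (dual (F.obj (𝟙_ C)))
    apply (tensorRight (F.obj (𝟙_ C))).map_injective
    dsimp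
    rw [← cancel_mono (μ _ _).hom]
    have h1 := associativity X (𝟙_ C) (𝟙_ C)
    have h2 := congr(F.obj X ◁ $(left (𝟙_ C)))
    simp only [whiskerLeft_comp] at h2
    rw [← triangle, h2]
    simp only [comp_whiskerRight, Category.assoc, natural_left, natural_right]
    rw [← associator_naturality_middle_assoc, ← reassoc_of% h1, ← F.map_comp, triangle]
  exact ⟨Functor.CoreMonoidal.toMonoidal
    { εIso := asIso ε
      μIso := μ
      μIso_hom_natural_left := natural_left
      μIso_hom_natural_right := natural_right
      associativity := associativity
      left_unitality := left
      right_unitality := right }⟩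

end

end CategoryTheory

/-! ### Equivalences in `C2G` as monoidal functors that are equivalences of categories -/

namespace Coherent2Group

/-- The inverse functor receives its monoidal structure from that of `e.functor` through the
adjunction; for this structure the unit and counit are monoidal. -/
lemma equivalent_of_equivalence {C D : Coherent2Group.{u}} (e : C ≌ D) [e.functor.Monoidal] :
    Equivalent C D := by
  let := e.inverseMonoidal
  have : e.IsMonoidal :=
    { leftAdjoint_ε := e.toAdjunction.homEquiv_unit _ _ _
      leftAdjoint_μ := fun _ _ => e.toAdjunction.homEquiv_unit _ _ _ }
  let F : C ⟶ D := { functor := e.functor }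
  let G : D ⟶ C := { functor := e.inverse }
  have : NatTrans.IsMonoidal e.unitIso.hom := inferInstanceAs (NatTrans.IsMonoidal e.unit)
  have : NatTrans.IsMonoidal e.counitIso.hom := inferInstanceAs (NatTrans.IsMonoidal e.counit)
  exact ⟨F, G, ⟨(isoMk (F := 𝟙 C) (G := F ≫ G) e.unitIso).symm⟩,
    ⟨isoMk (F := G ≫ F) (G := 𝟙 D) e.counitIso⟩⟩

lemma equivalent_of_isEquivalence {C D : Coherent2Group.{u}} (F : C ⥤ D) [F.Monoidal]
    [F.IsEquivalence] : Equivalent C D :=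
  have : F.asEquivalence.functor.Monoidal := inferInstanceAs F.Monoidal
  equivalent_of_equivalence F.asEquivalence

lemma Equivalent.exists_isEquivalence {C D : Coherent2Group.{u}} (h : Equivalent C D) :
    ∃ F : C ⟶ D, F.functor.IsEquivalence := by
  obtain ⟨F, G, ⟨a⟩, ⟨b⟩⟩ := h
  let natIso {C D : Coherent2Group.{u}} {F G : C ⟶ D} (e : F ≅ G) : F.functor ≅ G.functor :=
    { hom := e.hom.natTrans
      inv := e.inv.natTrans
      hom_inv_id := congrArg Hom₂.natTrans e.hom_inv_id
      inv_hom_id := congrArg Hom₂.natTrans e.inv_hom_id }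
  let e : C ≌ D := CategoryTheory.Equivalence.mk F.functor G.functor (natIso a).symm (natIso b)
  exact ⟨F, e.isEquivalence_functor⟩

end Coherent2Group

/-! ## The skeletal 2-group of a 3-cocycle -/

/-- A 3-cocycle on a group `G` with values in a `G`-module `H`. -/
@[ext]
structure ThreeCocycle (G H : Type*) [Group G] [AddCommGroup H] [DistribMulAction G H] where
  /-- the underlying function -/
  toFun : (Fin 3 → G) → H
  cocycle : ∀ g h k l : G, g • toFun ![h, k, l] - toFun ![g * h, k, l] + toFun ![g, h * k, l] -
    toFun ![g, h, k * l] + toFun ![g, h, k] = 0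

namespace ThreeCocycle

variable {G H : Type*} [Group G] [AddCommGroup H] [DistribMulAction G H] (a : ThreeCocycle G H)

/-- Cocycles are not assumed normalized. Here and below, values with an argument `1` are reduced to
`a(1, 1, g)` and `a(g, 1, 1)`, from which the unit laws of the skeletal 2-group are built. -/
lemma apply_one_one_one : a.toFun ![1, 1, 1] = 0 := by
  simpa using a.cocycle 1 1 1 1

lemma apply_mid_one (g h : G) :
    a.toFun ![g, 1, h] = g • a.toFun ![1, 1, h] + a.toFun ![g, 1, 1] := by
  have := a.cocycle g 1 1 h
  simp only [mul_one, one_mul] at this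
  rw [← sub_eq_zero, ← neg_eq_zero, ← this]
  abel

lemma apply_right_one (g h : G) :
    a.toFun ![g, h, 1] = a.toFun ![g * h, 1, 1] - g • a.toFun ![h, 1, 1] := by
  have := a.cocycle g h 1 1
  simp only [mul_one] at this
  rw [← sub_eq_zero, ← this]
  abel

lemma apply_left_one (g h : G) :
    a.toFun ![1, g, h] = a.toFun ![1, 1, g * h] - a.toFun ![1, 1, g] := by
  have := a.cocycle 1 1 g h
  simp only [one_mul, one_smul] at this
  rw [← sub_eq_zero, ← this]
  abel

/-- The objects of the skeletal 2-group of a 3-cocycle are the elements of the group. -/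
@[ext]
structure Skeleton (a : ThreeCocycle G H) where
  /-- the underlying element of the group -/
  elt : G

namespace Skeleton

variable {a}

/-- The morphisms of the skeletal 2-group are automorphisms, given by elements of the module. -/
@[ext]
structure Hom (X Y : Skeleton a) where
  eq : X.elt = Y.elt
  /-- the underlying element of the module -/
  val : H

@[simps id_val comp_val]
instance : Category (Skeleton a) where
  Hom := Hom
  id _ := ⟨rfl, 0⟩
  comp f g := ⟨f.eq.trans g.eq, f.val + g.val⟩
  id_comp _ := Hom.ext (zero_add _)
  comp_id _ := Hom.ext (add_zero _)
  assoc _ _ _ := Hom.ext (add_assoc _ _ _)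

/-- The morphism given by an element of the module. -/
@[simps]
def homMk {X Y : Skeleton a} (h : X.elt = Y.elt) (v : H) : X ⟶ Y := ⟨h, v⟩

@[ext]
lemma hom_ext {X Y : Skeleton a} {f g : X ⟶ Y} (h : f.val = g.val) : f = g := Hom.ext h

lemma Hom.obj_eq {X Y : Skeleton a} (f : X ⟶ Y) : X = Y := Skeleton.ext f.eq

lemma eqToHom_eq {X Y : Skeleton a} (h : X = Y) : eqToHom h = homMk (congrArg elt h) 0 := by
  subst h
  rfl

/-- The isomorphism given by an element of the module. -/
@[simps]
def isoMk {X Y : Skeleton a} (h : X.elt = Y.elt) (v : H) : X ≅ Y where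
  hom := homMk h v
  inv := homMk h.symm (-v)
  hom_inv_id := hom_ext (add_neg_cancel v)
  inv_hom_id := hom_ext (neg_add_cancel v)

instance : IsGroupoid (Skeleton a) where
  all_isIso f := (isoMk f.eq f.val).isIso_hom

/-- With these unitors the triangle identity is exactly `apply_mid_one`, and the pentagon is the
cocycle identity. -/
instance : MonoidalCategoryStruct (Skeleton a) where
  tensorObj X Y := ⟨X.elt * Y.elt⟩
  tensorUnit := ⟨1⟩
  whiskerLeft X _ _ f := homMk (congrArg (X.elt * ·) f.eq) (X.elt • f.val)
  whiskerRight f Y := homMk (congrArg (· * Y.elt) f.eq) f.val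
  associator X Y Z := isoMk (mul_assoc _ _ _) (a.toFun ![X.elt, Y.elt, Z.elt])
  leftUnitor X := isoMk (one_mul _) (-a.toFun ![1, 1, X.elt])
  rightUnitor X := isoMk (mul_one _) (a.toFun ![X.elt, 1, 1])

section

variable (X Y Z : Skeleton a) {X' Y' : Skeleton a} (f : X ⟶ Y) (g : X' ⟶ Y')

@[simp] lemma tensorObj_elt : (X ⊗ Y).elt = X.elt * Y.elt := rfl

@[simp] lemma tensorUnit_elt : (𝟙_ (Skeleton a)).elt = 1 := rfl

@[simp] lemma whiskerLeft_val : (X ◁ g).val = X.elt • g.val := rfl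

@[simp] lemma whiskerRight_val : (f ▷ Z).val = f.val := rfl

lemma tensorHom_val : (f ⊗ₘ g).val = f.val + Y.elt • g.val := rfl

@[simp] lemma associator_hom_val :
    (α_ X Y Z).hom.val = a.toFun ![X.elt, Y.elt, Z.elt] := rfl

@[simp] lemma associator_inv_val :
    (α_ X Y Z).inv.val = -a.toFun ![X.elt, Y.elt, Z.elt] := rfl

@[simp] lemma leftUnitor_hom_val : (λ_ X).hom.val = -a.toFun ![1, 1, X.elt] := rfl

@[simp] lemma leftUnitor_inv_val : (λ_ X).inv.val = a.toFun ![1, 1, X.elt] := neg_neg _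

@[simp] lemma rightUnitor_hom_val : (ρ_ X).hom.val = a.toFun ![X.elt, 1, 1] := rfl

@[simp] lemma rightUnitor_inv_val : (ρ_ X).inv.val = -a.toFun ![X.elt, 1, 1] := rfl

end

instance : MonoidalCategory (Skeleton a) where
  id_tensorHom_id _ _ := by ext; simp [tensorHom_val]
  tensorHom_comp_tensorHom f g f' g' := by
    ext
    simp [tensorHom_val, f'.eq]
    abel
  whiskerLeft_id _ _ := by ext; simp
  id_whiskerRight _ _ := by ext; simp
  associator_naturality f g h := by
    ext
    simp [tensorHom_val, f.eq, g.eq, h.eq, mul_smul]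
    abel
  leftUnitor_naturality f := by
    ext
    simp [f.eq, add_comm]
  rightUnitor_naturality f := by
    ext
    simp [f.eq, add_comm]
  pentagon W X Y Z := by
    ext
    simp only [comp_val, whiskerRight_val, associator_hom_val, whiskerLeft_val, tensorObj_elt]
    rw [← sub_eq_zero, ← a.cocycle W.elt X.elt Y.elt Z.elt]
    abel
  triangle X Y := by
    ext
    simp [a.apply_mid_one X.elt Y.elt]

instance (X : Skeleton a) : ExactPairing X (⟨X.elt⁻¹⟩ : Skeleton a) where
  coevaluation' := homMk (mul_inv_cancel _).symm 0
  -- This value is forced by the zig-zag identity for `X` once the coevaluation is `0`. The other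
  -- zig-zag identity is the cocycle identity at `(x⁻¹, x, x⁻¹, x)`.
  evaluation' := homMk (inv_mul_cancel _) (-(X.elt⁻¹ • (a.toFun ![X.elt, X.elt⁻¹, X.elt] +
    a.toFun ![1, 1, X.elt] + a.toFun ![X.elt, 1, 1])))
  coevaluation_evaluation' := by
    ext
    have := a.cocycle X.elt⁻¹ X.elt X.elt⁻¹ X.elt
    simp only [inv_mul_cancel, mul_inv_cancel, a.apply_left_one X.elt⁻¹ X.elt, a.apply_mid_one X.elt⁻¹ X.elt,
      a.apply_right_one X.elt⁻¹ X.elt, a.apply_one_one_one] at this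
    simp only [comp_val, whiskerRight_val, whiskerLeft_val, homMk_val, associator_inv_val,
      rightUnitor_hom_val, leftUnitor_inv_val, smul_zero, zero_add]
    rw [← sub_eq_zero, ← neg_eq_zero, ← this]
    simp only [smul_add]
    abel
  evaluation_coevaluation' := by
    ext
    simp
    abel

/-- The automorphism group of any object is the module. -/
def autEquiv (X : Skeleton a) : Multiplicative H ≃* Aut X where
  toFun h := isoMk rfl h.toAdd
  invFun e := .ofAdd e.hom.val
  left_inv _ := rfl
  right_inv _ := Iso.ext rfl
  map_mul' h h' := Iso.ext (hom_ext (add_comm h.toAdd h'.toAdd))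

lemma unitAct_eq (z : 𝟙_ (Skeleton a) ⟶ 𝟙_ (Skeleton a)) (X : Skeleton a) :
    unitAct z X = homMk rfl z.val := by
  ext
  simp [unitAct]

end Skeleton

end ThreeCocycle

/-- The skeletal 2-group of a 3-cocycle. -/
abbrev Coherent2Group.skeletal {G H : Type u} [Group G] [AddCommGroup H] [DistribMulAction G H]
    (a : ThreeCocycle G H) : Coherent2Group.{u} where
  carrier := a.Skeleton
  bar X := ⟨X.elt⁻¹⟩
  adj _ := inferInstance

/-! ## Coordinates and the skeletal 2-group -/

namespace Coherent2Group

section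

variable (C : Coherent2Group.{u}) (x : C)

@[simp]
lemma toUnit_unitAct (z : 𝟙_ C ⟶ 𝟙_ C) : C.toUnit x (unitAct z x) = z := by
  rw [toUnit, unitAct_whiskerRight, ← unitAct_naturality_assoc]
  simp

@[simp]
lemma unitAct_toUnit (f : x ⟶ x) : unitAct (C.toUnit x f) x = f := by
  have := isEquivalence_tensorRight_of_exactPairing x (C.bar x)
  obtain ⟨z, hz⟩ := (tensorRight x).map_surjective ((λ_ x).hom ≫ f ≫ (λ_ x).inv)
  obtain rfl : f = unitAct z x := by
    dsimp at hz
    simp [unitAct, hz]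
  simp

/-- Rewrites the equations of `Coordinates` without `bar x` and `i_x`; in particular `toUnit` does
not depend on their choice. -/
lemma eq_toUnit_iff (f : x ⟶ x) (z : 𝟙_ C ⟶ 𝟙_ C) : z = C.toUnit x f ↔ unitAct z x = f :=
  ⟨fun h => by simp [h], fun h => by simp [← h]⟩

end

namespace Coordinates

variable {C : Coherent2Group.{u}} {G H : Type u} [Group G] [AddCommGroup H] [DistribMulAction G H]

section

variable {a : (Fin 3 → G) → H} (c : C.Coordinates a)

/-- The automorphism of the unit object given by an element of `H`. -/
def unitHom (h : H) : 𝟙_ C ⟶ 𝟙_ C := (c.aut (.ofAdd h)).hom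

@[simp]
lemma unitHom_zero : c.unitHom 0 = 𝟙 _ := by
  simp only [unitHom, ofAdd_zero, map_one]
  rfl

lemma unitHom_add (h h' : H) : c.unitHom (h + h') = c.unitHom h ≫ c.unitHom h' := by
  simp only [unitHom, ofAdd_add, map_mul]
  -- Multiplication in `Aut` is composition in the opposite order.
  exact unitEnd_comm _ _

lemma unitHom_injective : Function.Injective c.unitHom := fun h h' e => by
  simpa using c.aut.injective (Iso.ext e : c.aut (.ofAdd h) = c.aut (.ofAdd h'))

lemma unitHom_surjective : Function.Surjective c.unitHom := fun z => by
  obtain ⟨h, hh⟩ := c.aut.surjective (asIso z)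
  exact ⟨h.toAdd, by simp [unitHom, hh]⟩

lemma whiskerLeft_unitAct_unitHom (g : G) (h : H) (Y : C) :
    c.rep g ◁ unitAct (c.unitHom h) Y = unitAct (c.unitHom (g • h)) (c.rep g ⊗ Y) := by
  rw [whiskerLeft_unitAct, ← unitAct_whiskerRight]
  congr 1
  exact ((eq_toUnit_iff ..).1 (c.action g h)).symm

lemma mul_associator (g₁ g₂ g₃ : G) :
    (c.mul g₁ g₂).hom ▷ c.rep g₃ ≫ (c.mul (g₁ * g₂) g₃).hom ≫
        unitAct (c.unitHom (a ![g₁, g₂, g₃])) _ ≫ eqToHom (congrArg c.rep (mul_assoc g₁ g₂ g₃)) =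
      (α_ (c.rep g₁) (c.rep g₂) (c.rep g₃)).hom ≫
        c.rep g₁ ◁ (c.mul g₂ g₃).hom ≫ (c.mul g₁ (g₂ * g₃)).hom := by
  have := (eq_toUnit_iff ..).1 (c.associator g₁ g₂ g₃)
  rw [unitHom, this]
  simp

end

variable {a : ThreeCocycle G H} (c : C.Coordinates a.toFun)

/-- The functor from the skeletal 2-group given by coordinates. -/
@[simps]
def functor : a.Skeleton ⥤ C where
  obj X := c.rep X.elt
  map f := unitAct (c.unitHom f.val) _ ≫ eqToHom (congrArg c.rep f.eq)
  map_id X := by simp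
  map_comp f g := by
    obtain rfl := f.obj_eq
    obtain rfl := g.obj_eq
    simp [unitHom_add, unitAct_comp]

open ThreeCocycle.Skeleton in
instance : c.functor.IsEquivalence where
  faithful.map_injective {X Y f g} h := by
    obtain rfl := f.obj_eq
    ext
    apply c.unitHom_injective
    refine unitAct_injective (c.rep X.elt) (C.bar (c.rep X.elt)) ?_
    exact (cancel_mono (eqToHom (congrArg c.rep f.eq))).1 h
  full.map_surjective {X Y} f := by
    change c.rep X.elt ⟶ c.rep Y.elt at f
    -- Representatives joined by a morphism are isomorphic, hence equal by uniqueness.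
    obtain rfl : X = Y := ThreeCocycle.Skeleton.ext <|
      (c.existsUnique_rep (c.rep X.elt)).unique ⟨Iso.refl _⟩ ⟨asIso f⟩
    obtain ⟨h, hh⟩ := c.unitHom_surjective (C.toUnit _ f)
    exact ⟨homMk rfl h, by
      rw [functor_map, homMk_val, hh, eqToHom_refl, Category.comp_id, unitAct_toUnit]⟩
  essSurj.mem_essImage x := by
    obtain ⟨g, ⟨e⟩, -⟩ := c.existsUnique_rep x
    exact ⟨⟨g⟩, ⟨e.symm⟩⟩

-- `mul` serves as the tensor constraint: the action formula gives its naturality in the second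
-- variable, and the associator formula its coherence.
include c in
lemma equivalent_skeletal : Equivalent (skeletal a) C := by
  obtain ⟨_⟩ := nonempty_monoidal C.bar c.functor (fun X Y => c.mul X.elt Y.elt)
    (fun f Z => by
      obtain rfl := f.obj_eq
      change (unitAct _ (c.rep _) ≫ 𝟙 _) ▷ c.rep _ ≫ _ = _ ≫ unitAct _ _ ≫ 𝟙 _
      simpa [unitAct_whiskerRight] using unitAct_naturality _ _)
    (fun Z f => by
      obtain rfl := f.obj_eq
      change c.rep _ ◁ (unitAct _ (c.rep _) ≫ 𝟙 _) ≫ _ = _ ≫ unitAct _ _ ≫ 𝟙 _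
      simpa [whiskerLeft_unitAct_unitHom] using unitAct_naturality _ _)
    (fun X Y Z => c.mul_associator X.elt Y.elt Z.elt)
  exact equivalent_of_isEquivalence (C := skeletal a) c.functor

end Coordinates

open ThreeCocycle.Skeleton Functor.LaxMonoidal Functor.OplaxMonoidal in
/-- The coordinates given by a monoidal equivalence from a skeletal 2-group. -/
noncomputable def coordinatesOfEquivalence {C : Coherent2Group.{u}} {G H : Type u} [Group G]
    [AddCommGroup H] [DistribMulAction G H] {a : ThreeCocycle G H} (F : a.Skeleton ⥤ C)
    [F.Monoidal] [F.IsEquivalence] : C.Coordinates a.toFun where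
  rep g := F.obj ⟨g⟩
  existsUnique_rep x := ⟨(F.objPreimage x).elt, ⟨(F.objObjPreimageIso x).symm⟩, fun g ⟨e⟩ =>
    (F.preimageIso (e.symm ≪≫ (F.objObjPreimageIso x).symm)).hom.eq⟩
  mul g h := Functor.Monoidal.μIso F ⟨g⟩ ⟨h⟩
  aut := (autEquiv (𝟙_ _)).trans <| ((Functor.FullyFaithful.ofFullyFaithful
    F).autMulEquivOfFullyFaithful _).trans (Aut.autMulEquivOfIso (Functor.Monoidal.εIso F).symm)
  action g h := by
    rw [eq_toUnit_iff]
    -- Both sides are images under `F`, so the equation can be checked in the skeleton, on values in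
    -- `H`.
    refine (map_unitAct F (homMk rfl (g • h)) ⟨g⟩).symm.trans
      (.trans ?_ (map_rightUnitor_conj F (homMk rfl h) ⟨g⟩))
    congr 1
    ext
    simp [unitAct_eq]
  associator g₁ g₂ g₃ := by
    rw [eq_toUnit_iff]
    refine (map_unitAct F (homMk rfl (a.toFun ![g₁, g₂, g₃])) ⟨g₁ * g₂ * g₃⟩).symm.trans ?_
    have h := Functor.Monoidal.map_associator F ⟨g₁⟩ ⟨g₂⟩ ⟨g₃⟩
    have h' : unitAct (homMk rfl (a.toFun ![g₁, g₂, g₃])) (⟨g₁ * g₂ * g₃⟩ : a.Skeleton) =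
        (α_ (⟨g₁⟩ : a.Skeleton) ⟨g₂⟩ ⟨g₃⟩).hom ≫
          eqToHom (congrArg ThreeCocycle.Skeleton.mk (mul_assoc g₁ g₂ g₃).symm) := by
      ext
      simp [unitAct_eq, eqToHom_eq]
    rw [h', F.map_comp, h, eqToHom_map]
    simp only [Category.assoc]
    rfl

lemma nonempty_coordinates_of_equivalent {C : Coherent2Group.{u}} {G H : Type u} [Group G]
    [AddCommGroup H] [DistribMulAction G H] {a : ThreeCocycle G H}
    (h : Equivalent (skeletal a) C) : Nonempty (C.Coordinates a.toFun) := by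
  obtain ⟨F, hF⟩ := h.exists_isEquivalence
  let F' : a.Skeleton ⥤ C := F.functor
  have : F'.Monoidal := F.monoidal
  exact ⟨coordinatesOfEquivalence F'⟩

end Coherent2Group

/-! ## Equivalences of skeletal 2-groups -/

namespace ThreeCocycle

variable {G H G' H' : Type u} [Group G] [AddCommGroup H] [DistribMulAction G H]
  [Group G'] [AddCommGroup H'] [DistribMulAction G' H']

/-- The condition on isomorphisms of groups and modules and on a 2-cochain to define a monoidal
functor between skeletal 2-groups. -/
def IsCompatible (a : ThreeCocycle G H) (a' : ThreeCocycle G' H') (φ : G ≃* G') (ψ : H ≃+ H')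
    (b : G → G → H') : Prop :=
  ∀ g₁ g₂ g₃ : G, b g₁ g₂ + (b (g₁ * g₂) g₃ + ψ (a.toFun ![g₁, g₂, g₃])) =
    a'.toFun ![φ g₁, φ g₂, φ g₃] + (φ g₁ • b g₂ g₃ + b g₁ (g₂ * g₃))

variable {a : ThreeCocycle G H} {a' : ThreeCocycle G' H'}

open Skeleton

/-- The functor between skeletal 2-groups given by isomorphisms of groups and modules. -/
@[simps]
def mapSkeleton (a : ThreeCocycle G H) (a' : ThreeCocycle G' H') (φ : G ≃* G') (ψ : H ≃+ H') :
    a.Skeleton ⥤ a'.Skeleton where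
  obj X := ⟨φ X.elt⟩
  map f := homMk (congrArg φ f.eq) (ψ f.val)

instance (φ : G ≃* G') (ψ : H ≃+ H') : (mapSkeleton a a' φ ψ).IsEquivalence where
  faithful.map_injective {X Y f g} h := by
    ext
    exact ψ.injective (congrArg Hom.val h)
  full.map_surjective {X Y} f :=
    ⟨homMk (φ.injective f.eq) (ψ.symm f.val), by ext; simp⟩
  essSurj.mem_essImage X := ⟨⟨φ.symm X.elt⟩, ⟨isoMk (φ.apply_symm_apply _) 0⟩⟩

lemma IsCompatible.equivalent {φ : G ≃* G'} {ψ : H ≃+ H'} {b : G → G → H'}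
    (hψ : ∀ (g : G) (h : H), ψ (g • h) = φ g • ψ h) (h : IsCompatible a a' φ ψ b) :
    Coherent2Group.Equivalent (.skeletal a) (.skeletal a') := by
  obtain ⟨_⟩ := nonempty_monoidal (fun X => ⟨X.elt⁻¹⟩) (mapSkeleton a a' φ ψ)
    (fun X Y => isoMk (map_mul φ X.elt Y.elt).symm (b X.elt Y.elt))
    (fun f Z => by
      obtain rfl := f.obj_eq
      exact hom_ext (add_comm _ _))
    (fun Z f => by
      obtain rfl := f.obj_eq
      exact hom_ext ((add_comm _ _).trans (congrArg _ (hψ Z.elt f.val).symm)))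
    (fun X Y Z => hom_ext (h X.elt Y.elt Z.elt))
  exact Coherent2Group.equivalent_of_isEquivalence (C := .skeletal a) (D := .skeletal a')
    (mapSkeleton a a' φ ψ)

/-! ### Invariants of a monoidal functor between skeletal 2-groups -/

section

open Functor.LaxMonoidal Functor.OplaxMonoidal

variable (F : a.Skeleton ⥤ a'.Skeleton)

/-- The homomorphism of modules given by a monoidal functor between skeletal 2-groups. -/
def moduleMap : H →+ H' :=
  AddMonoidHom.mk' (fun h => (F.map (homMk rfl h : 𝟙_ _ ⟶ 𝟙_ a.Skeleton)).val) fun h h' =>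
    congrArg Hom.val (F.map_comp (homMk rfl h : 𝟙_ _ ⟶ 𝟙_ a.Skeleton) (homMk rfl h'))

lemma moduleMap_bijective [F.IsEquivalence] : Function.Bijective (moduleMap F) := by
  refine ⟨fun h h' e => ?_, fun h' => ?_⟩
  · exact congrArg Hom.val (F.map_injective (hom_ext e :
      F.map (homMk rfl h : 𝟙_ _ ⟶ 𝟙_ a.Skeleton) = F.map (homMk rfl h')))
  · exact ⟨(F.preimage (homMk rfl h' : F.obj (𝟙_ a.Skeleton) ⟶ F.obj (𝟙_ a.Skeleton))).val,
      congrArg Hom.val (F.map_preimage (homMk rfl h'))⟩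

variable [F.Monoidal]

/-- The automorphism `h` of `X` is the action on `X` of the automorphism `h` of the unit object. `F`
preserves this action up to conjugation by `ε`, which is invisible on values in an abelian group. -/
lemma map_val_unitAct (h : H) (X : a.Skeleton) :
    (F.map (homMk rfl h : X ⟶ X)).val = (F.map (homMk rfl h : 𝟙_ _ ⟶ 𝟙_ a.Skeleton)).val := by
  have h1 := map_unitAct F (homMk rfl h) X
  rw [unitAct_eq, unitAct_eq] at h1
  have h2 := congrArg Hom.val h1
  have h3 := congrArg Hom.val (Functor.Monoidal.ε_η F)
  simp only [comp_val, homMk_val, id_val] at h2 h3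
  rw [h2, add_left_comm, h3, add_zero]

/-- The homomorphism of groups given by a monoidal functor between skeletal 2-groups. -/
def groupHom : G →* G' :=
  MonoidHom.mk' (fun g => (F.obj ⟨g⟩).elt) fun g h => (μ F ⟨g⟩ ⟨h⟩).eq.symm

lemma map_val (h : H) (X : a.Skeleton) : (F.map (homMk rfl h : X ⟶ X)).val = moduleMap F h :=
  map_val_unitAct F h X

lemma moduleMap_smul (g : G) (h : H) : moduleMap F (g • h) = groupHom F g • moduleMap F h := by
  have h1 := congrArg Hom.val
    (map_rightUnitor_conj F (homMk rfl h : 𝟙_ _ ⟶ 𝟙_ a.Skeleton) (⟨g⟩ : a.Skeleton))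
  have h2 : (ρ_ (⟨g⟩ : a.Skeleton)).inv ≫ ⟨g⟩ ◁ (homMk rfl h) ≫ (ρ_ (⟨g⟩ : a.Skeleton)).hom =
      homMk rfl (g • h) := by
    ext
    simp
  have h3 := congrArg Hom.val (Functor.Monoidal.ε_η F)
  rw [h2, map_val] at h1
  simp only [comp_val, id_val, rightUnitor_inv_val, rightUnitor_hom_val, whiskerLeft_val] at h1 h3
  rw [h1, add_left_comm _ (F.map _).val, h3, add_zero]
  rw [add_comm, add_neg_cancel_right]
  rfl

lemma groupHom_bijective [F.IsEquivalence] : Function.Bijective (groupHom F) := by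
  refine ⟨fun g g' h => ?_, fun g' => ?_⟩
  · exact (F.preimage (homMk h 0 : F.obj ⟨g⟩ ⟶ F.obj ⟨g'⟩)).eq
  · exact ⟨(F.objPreimage ⟨g'⟩).elt, (F.objObjPreimageIso ⟨g'⟩).hom.eq⟩

lemma map_associator_val (g₁ g₂ g₃ : G) :
    (F.map (α_ (⟨g₁⟩ : a.Skeleton) ⟨g₂⟩ ⟨g₃⟩).hom).val = moduleMap F (a.toFun ![g₁, g₂, g₃]) := by
  have h : (α_ (⟨g₁⟩ : a.Skeleton) ⟨g₂⟩ ⟨g₃⟩).hom = homMk rfl (a.toFun ![g₁, g₂, g₃]) ≫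
      eqToHom (congrArg ThreeCocycle.Skeleton.mk (mul_assoc g₁ g₂ g₃)) := by
    ext
    simp [eqToHom_eq]
  rw [h, F.map_comp, eqToHom_map, eqToHom_eq, comp_val, homMk_val, add_zero, map_val]

end

lemma exists_isCompatible_of_equivalent
    (h : Coherent2Group.Equivalent (.skeletal a) (.skeletal a')) :
    ∃ (φ : G ≃* G') (ψ : H ≃+ H') (b : G → G → H'),
      (∀ (g : G) (h : H), ψ (g • h) = φ g • ψ h) ∧ IsCompatible a a' φ ψ b := by
  obtain ⟨F', hF'⟩ := h.exists_isEquivalence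
  let F : a.Skeleton ⥤ a'.Skeleton := F'.functor
  have : F.Monoidal := F'.monoidal
  have : F.IsEquivalence := hF'
  refine ⟨MulEquiv.ofBijective _ (groupHom_bijective F),
    AddEquiv.ofBijective _ (moduleMap_bijective F),
    fun g h => (Functor.LaxMonoidal.μ F ⟨g⟩ ⟨h⟩).val, moduleMap_smul F, fun g₁ g₂ g₃ => ?_⟩
  have h := congrArg Hom.val (Functor.LaxMonoidal.associativity F ⟨g₁⟩ ⟨g₂⟩ ⟨g₃⟩)
  simp only [comp_val, map_associator_val] at h
  exact h

end ThreeCocycle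

/-! ## Existence of coordinates -/

namespace CategoryTheory

/-- If multiplications of objects are associative up to automorphisms of the unit object, the
pentagon axiom gives a relation between these automorphisms. -/
lemma unitAct_pentagon {C : Type*} [Category* C] [MonoidalCategory C]
    {X₁ X₂ X₃ X₄ X₁₂ X₂₃ X₃₄ X₁₂₃ X₂₃₄ W : C}
    {m₁₂ : X₁ ⊗ X₂ ⟶ X₁₂} {m₂₃ : X₂ ⊗ X₃ ⟶ X₂₃} {m₃₄ : X₃ ⊗ X₄ ⟶ X₃₄}
    {m : X₁₂ ⊗ X₃ ⟶ X₁₂₃} {m' : X₁ ⊗ X₂₃ ⟶ X₁₂₃} {n : X₂₃ ⊗ X₄ ⟶ X₂₃₄} {n' : X₂ ⊗ X₃₄ ⟶ X₂₃₄}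
    {p : X₁₂₃ ⊗ X₄ ⟶ W} {q : X₁₂ ⊗ X₃₄ ⟶ W} {r : X₁ ⊗ X₂₃₄ ⟶ W}
    {z₁ z₂ z₃ z₃' z₄ z₅ : 𝟙_ C ⟶ 𝟙_ C}
    (e₁ : m₁₂ ▷ X₃ ≫ m ≫ unitAct z₁ _ = (α_ _ _ _).hom ≫ X₁ ◁ m₂₃ ≫ m')
    (e₂ : m' ▷ X₄ ≫ p ≫ unitAct z₂ _ = (α_ _ _ _).hom ≫ X₁ ◁ n ≫ r)
    (e₃ : m₂₃ ▷ X₄ ≫ n ≫ unitAct z₃ _ = (α_ _ _ _).hom ≫ X₂ ◁ m₃₄ ≫ n')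
    (e₄ : m ▷ X₄ ≫ p ≫ unitAct z₄ _ = (α_ _ _ _).hom ≫ X₁₂ ◁ m₃₄ ≫ q)
    (e₅ : m₁₂ ▷ X₃₄ ≫ q ≫ unitAct z₅ _ = (α_ _ _ _).hom ≫ X₁ ◁ n' ≫ r)
    (h : X₁ ◁ unitAct z₃ X₂₃₄ = unitAct z₃' _) :
    m₁₂ ▷ X₃ ▷ X₄ ≫ m ▷ X₄ ≫ p ≫ unitAct (z₁ ≫ z₂ ≫ z₃') _ =
      m₁₂ ▷ X₃ ▷ X₄ ≫ m ▷ X₄ ≫ p ≫ unitAct (z₄ ≫ z₅) _ := by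
  have e₁' := congr($e₁ ▷ X₄)
  have e₃' := congr(X₁ ◁ $e₃)
  simp only [comp_whiskerRight, MonoidalCategory.whiskerLeft_comp] at e₁' e₃'
  simp only [unitAct_comp]
  -- Both sides equal the composite through the fully right-bracketed product: `e₁`, `e₂`, `e₃` and
  -- the pentagon lead there, `e₅` and `e₄` lead back.
  calc
    _ = (m₁₂ ▷ X₃ ▷ X₄ ≫ m ▷ X₄ ≫ unitAct z₁ _ ▷ X₄) ≫ p ≫ unitAct z₂ _ ≫ unitAct z₃' _ := by
      rw [unitAct_whiskerRight]
      simp only [Category.assoc]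
      rw [unitAct_naturality_assoc z₁ p]
    _ = (α_ _ _ _).hom ▷ X₄ ≫ (X₁ ◁ m₂₃) ▷ X₄ ≫ (m' ▷ X₄ ≫ p ≫ unitAct z₂ _) ≫
        unitAct z₃' _ := by
      rw [e₁']
      simp only [Category.assoc]
    _ = (α_ _ _ _).hom ▷ X₄ ≫ (α_ _ _ _).hom ≫
        (X₁ ◁ m₂₃ ▷ X₄ ≫ X₁ ◁ n ≫ X₁ ◁ unitAct z₃ _) ≫ r := by
      rw [e₂, h]
      simp only [Category.assoc, associator_naturality_middle_assoc]
      rw [unitAct_naturality z₃' r]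
    _ = (α_ _ _ _).hom ≫ (α_ _ _ _).hom ≫ X₁ ◁ X₂ ◁ m₃₄ ≫ X₁ ◁ n' ≫ r := by
      rw [e₃']
      simp only [Category.assoc, pentagon_assoc]
    _ = (α_ _ _ _).hom ≫ (X₁ ⊗ X₂) ◁ m₃₄ ≫ m₁₂ ▷ X₃₄ ≫ q ≫ unitAct z₅ _ := by
      rw [e₅]
      simp only [associator_naturality_right_assoc]
    _ = m₁₂ ▷ X₃ ▷ X₄ ≫ (m ▷ X₄ ≫ p ≫ unitAct z₄ _) ≫ unitAct z₅ _ := by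
      rw [e₄]
      simp only [Category.assoc, whisker_exchange_assoc, associator_naturality_left_assoc]
    _ = _ := by simp only [Category.assoc]

end CategoryTheory

namespace Coherent2Group

namespace Coordinates

variable {C : Coherent2Group.{u}} {G H : Type u} [Group G] [AddCommGroup H] [DistribMulAction G H]
  {a : (Fin 3 → G) → H} (c : C.Coordinates a)

/-- The multiplication of coordinates, with a variable for the product. -/
def mulTo (g h k : G) (e : g * h = k) : c.rep g ⊗ c.rep h ≅ c.rep k :=
  c.mul g h ≪≫ eqToIso (congrArg c.rep e)

/-- Naming the products separately absorbs the transports along `mul_assoc`, so that five instances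
fit together in one pentagon. -/
lemma mulTo_associator {g₁ g₂ g₃ x y w : G} (hx : g₁ * g₂ = x) (hy : g₂ * g₃ = y)
    (hw : x * g₃ = w) (hw' : g₁ * y = w) :
    (c.mulTo g₁ g₂ x hx).hom ▷ c.rep g₃ ≫ (c.mulTo x g₃ w hw).hom ≫
        unitAct (c.unitHom (a ![g₁, g₂, g₃])) _ =
      (α_ (c.rep g₁) (c.rep g₂) (c.rep g₃)).hom ≫
        c.rep g₁ ◁ (c.mulTo g₂ g₃ y hy).hom ≫ (c.mulTo g₁ y w hw').hom := by
  subst hx hy hw'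
  have := c.mul_associator g₁ g₂ g₃
  simp only [mulTo, Iso.trans_hom, eqToIso.hom, eqToHom_refl, Category.comp_id, Category.assoc]
  rw [← unitAct_naturality, this]

-- The five associators of the pentagon on `g, h, k, l` give the five terms; the one whiskered by
-- `c.rep g` acquires the factor `g •`.
include c in
lemma cocycle (g h k l : G) : g • a ![h, k, l] - a ![g * h, k, l] + a ![g, h * k, l] -
    a ![g, h, k * l] + a ![g, h, k] = 0 := by
  have e₁ := c.mulTo_associator (g₁ := g) (g₂ := h) (g₃ := k) rfl rfl rfl (mul_assoc _ _ _).symm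
  have e₂ := c.mulTo_associator (g₁ := g) (g₂ := h * k) (g₃ := l) (mul_assoc _ _ _).symm rfl rfl
    (by simp only [mul_assoc])
  have e₃ := c.mulTo_associator (g₁ := h) (g₂ := k) (g₃ := l) rfl rfl rfl (mul_assoc _ _ _).symm
  have e₄ := c.mulTo_associator (g₁ := g * h) (g₂ := k) (g₃ := l) rfl rfl rfl
    (mul_assoc _ _ _).symm
  have e₅ := c.mulTo_associator (g₁ := g) (g₂ := h) (g₃ := k * l) rfl
    (mul_assoc _ _ _).symm (mul_assoc _ _ _).symm (by simp only [mul_assoc])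
  have key := unitAct_pentagon e₁ e₂ e₃ e₄ e₅ (c.whiskerLeft_unitAct_unitHom g _ _)
  simp only [← c.unitHom_add, cancel_epi] at key
  have := c.unitHom_injective (unitAct_injective _ (C.bar (c.rep (g * h * k * l))) key)
  rw [← sub_eq_zero] at this
  rw [← this]
  abel

end Coordinates

/-! ### The action of isomorphism classes on `Aut(𝟙_)` -/

section

variable (C : Coherent2Group.{u})

/-- The action of an object on the automorphisms of the unit object. -/
noncomputable def conj (x : C) (z : 𝟙_ C ⟶ 𝟙_ C) : 𝟙_ C ⟶ 𝟙_ C :=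
  C.toUnit x ((ρ_ x).inv ≫ x ◁ z ≫ (ρ_ x).hom)

variable {C}

lemma eq_conj_iff (x : C) (z w : 𝟙_ C ⟶ 𝟙_ C) :
    w = conj C x z ↔ unitAct w x = (ρ_ x).inv ≫ x ◁ z ≫ (ρ_ x).hom := eq_toUnit_iff ..

lemma unitAct_conj (x : C) (z : 𝟙_ C ⟶ 𝟙_ C) :
    unitAct (conj C x z) x = (ρ_ x).inv ≫ x ◁ z ≫ (ρ_ x).hom := unitAct_toUnit ..

/-- Makes the action well defined on isomorphism classes. -/
lemma conj_congr {x y : C} (e : x ≅ y) (z : 𝟙_ C ⟶ 𝟙_ C) : conj C x z = conj C y z := by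
  rw [eq_conj_iff, ← cancel_epi e.hom, ← unitAct_naturality, unitAct_conj]
  simp only [Category.assoc, ← rightUnitor_naturality, rightUnitor_inv_naturality_assoc]
  rw [whisker_exchange_assoc]

lemma conj_unit (z : 𝟙_ C ⟶ 𝟙_ C) : conj C (𝟙_ C) z = z := by
  symm
  simp [eq_conj_iff, unitors_equal, unitors_inv_equal]

lemma conj_tensor (x y : C) (z : 𝟙_ C ⟶ 𝟙_ C) : conj C (x ⊗ y) z = conj C x (conj C y z) := by
  symm
  rw [eq_conj_iff, ← unitAct_whiskerRight, unitAct_conj, ← whiskerLeft_unitAct, unitAct_conj]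
  simp

lemma conj_comp (x : C) (z w : 𝟙_ C ⟶ 𝟙_ C) :
    conj C x (z ≫ w) = conj C x z ≫ conj C x w := by
  symm
  rw [eq_conj_iff, unitAct_comp, unitAct_conj, unitAct_conj]
  simp

lemma conj_id (x : C) : conj C x (𝟙 _) = 𝟙 _ := by
  symm
  simp [eq_conj_iff]

variable (C)

/-- The isomorphism classes of objects of a coherent 2-group. -/
def Classes : Type u := Quotient (isIsomorphicSetoid C)

namespace Classes

variable {C}

/-- The class of an object. -/
def mk (x : C) : C.Classes := Quotient.mk (isIsomorphicSetoid C) x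

lemma mk_eq_mk {x y : C} : mk x = mk y ↔ Nonempty (x ≅ y) := Quotient.eq (r := isIsomorphicSetoid C)

/-- A representative of a class. -/
noncomputable def out (g : C.Classes) : C := Quotient.out g

@[simp]
lemma mk_out (g : C.Classes) : mk g.out = g := Quotient.out_eq g

lemma ind {p : C.Classes → Prop} (h : ∀ x, p (mk x)) (g : C.Classes) : p g := Quotient.ind h g

instance : Mul C.Classes where
  mul := Quotient.map₂ (fun x y => x ⊗ y) fun _ _ ⟨e⟩ _ _ ⟨f⟩ => ⟨e ⊗ᵢ f⟩

lemma mk_mul_mk (x y : C) : mk x * mk y = mk (x ⊗ y) := rfl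

instance : One C.Classes := ⟨mk (𝟙_ C)⟩

noncomputable instance : Inv C.Classes := ⟨fun g => mk (C.bar g.out)⟩

noncomputable instance : Group C.Classes :=
  Group.ofLeftAxioms
    (ind fun x => ind fun y => ind fun z => mk_eq_mk.2 ⟨α_ x y z⟩)
    (ind fun x => mk_eq_mk.2 ⟨λ_ x⟩)
    (fun g => by
      conv_lhs => rw [← mk_out g]
      rw [mk_out]
      nth_rw 2 [← mk_out g]
      exact mk_eq_mk.2 ⟨asIso (ε_ g.out (C.bar g.out))⟩)

/-- The multiplication of representatives. -/
noncomputable def outMul (g h : C.Classes) : g.out ⊗ h.out ≅ (g * h).out :=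
  Nonempty.some <| mk_eq_mk.1 <| by rw [← mk_mul_mk, mk_out, mk_out, mk_out]

lemma nonempty_out_one : Nonempty ((1 : C.Classes).out ≅ 𝟙_ C) :=
  mk_eq_mk.1 (mk_out 1)

end Classes

noncomputable instance : AddCommGroup (Additive (Aut (𝟙_ C))) :=
  { (inferInstance : AddGroup (Additive (Aut (𝟙_ C)))) with
    add_comm := fun f g => Iso.ext (unitEnd_comm g.toMul.hom f.toMul.hom) }

noncomputable instance : DistribMulAction C.Classes (Additive (Aut (𝟙_ C))) where
  smul g h := .ofMul (asIso (conj C g.out h.toMul.hom))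
  one_smul _ := Iso.ext ((conj_congr Classes.nonempty_out_one.some _).trans (conj_unit _))
  mul_smul g g' _ :=
    Iso.ext ((conj_congr (Classes.outMul g g').symm _).trans (conj_tensor _ _ _))
  smul_zero _ := Iso.ext (conj_id _)
  smul_add _ _ _ := Iso.ext (conj_comp _ _ _)

/-- Every coherent 2-group has coordinates. -/
noncomputable def coordinates : C.Coordinates (G := C.Classes) (H := Additive (Aut (𝟙_ C)))
    (fun g => .ofMul <| asIso <| C.toUnit (g 0 * g 1 * g 2).out
      ((Classes.outMul (g 0 * g 1) (g 2)).inv ≫ (Classes.outMul (g 0) (g 1)).inv ▷ (g 2).out ≫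
        (α_ (g 0).out (g 1).out (g 2).out).hom ≫ (g 0).out ◁ (Classes.outMul (g 1) (g 2)).hom ≫
        (Classes.outMul (g 0) (g 1 * g 2)).hom ≫
        eqToHom (congrArg Classes.out (mul_assoc (g 0) (g 1) (g 2)).symm))) where
  rep := Classes.out
  existsUnique_rep x :=
    ⟨.mk x, Classes.mk_eq_mk.1 (Classes.mk_out _).symm, fun g h => by
      rw [Classes.mk_eq_mk.2 h, Classes.mk_out]⟩
  mul := Classes.outMul
  aut := MulEquiv.refl _
  action _ _ := rfl
  associator _ _ _ := rfl

end

end Coherent2Group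

/-! ## Third group cohomology -/

namespace groupCohomology

variable {k G : Type u} [CommRing k] [Group G] (A : Rep.{u} k G)

lemma inhomogeneousCochains_d_two_apply (f : (Fin 2 → G) → A) (g₁ g₂ g₃ : G) :
    (inhomogeneousCochains.d A 2).hom f ![g₁, g₂, g₃] =
      A.ρ g₁ (f ![g₂, g₃]) - f ![g₁ * g₂, g₃] + f ![g₁, g₂ * g₃] - f ![g₁, g₂] := by
  rw [inhomogeneousCochains.d_hom_apply, Fin.sum_univ_three]
  have e0 : (fun i : Fin 2 => (![g₁, g₂, g₃] : Fin 3 → G) i.succ) = ![g₂, g₃] := by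
    ext i; fin_cases i <;> rfl
  have e1 : Fin.contractNth 0 (· * ·) ![g₁, g₂, g₃] = ![g₁ * g₂, g₃] := by
    ext i; fin_cases i <;> rfl
  have e2 : Fin.contractNth 1 (· * ·) ![g₁, g₂, g₃] = ![g₁, g₂ * g₃] := by
    ext i; fin_cases i <;> rfl
  have e3 : Fin.contractNth 2 (· * ·) ![g₁, g₂, g₃] = ![g₁, g₂] := by
    ext i; fin_cases i <;> rfl
  rw [e0, e1, e2, e3]
  simp [pow_succ, sub_eq_add_neg, add_assoc]

lemma inhomogeneousCochains_d_three_apply (f : (Fin 3 → G) → A) (g₁ g₂ g₃ g₄ : G) :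
    (inhomogeneousCochains.d A 3).hom f ![g₁, g₂, g₃, g₄] =
      A.ρ g₁ (f ![g₂, g₃, g₄]) - f ![g₁ * g₂, g₃, g₄] + f ![g₁, g₂ * g₃, g₄] -
        f ![g₁, g₂, g₃ * g₄] + f ![g₁, g₂, g₃] := by
  rw [inhomogeneousCochains.d_hom_apply, Fin.sum_univ_four]
  have e0 : (fun i : Fin 3 => (![g₁, g₂, g₃, g₄] : Fin 4 → G) i.succ) = ![g₂, g₃, g₄] := by
    ext i; fin_cases i <;> rfl
  have e1 : Fin.contractNth 0 (· * ·) ![g₁, g₂, g₃, g₄] = ![g₁ * g₂, g₃, g₄] := by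
    ext i; fin_cases i <;> rfl
  have e2 : Fin.contractNth 1 (· * ·) ![g₁, g₂, g₃, g₄] = ![g₁, g₂ * g₃, g₄] := by
    ext i; fin_cases i <;> rfl
  have e3 : Fin.contractNth 2 (· * ·) ![g₁, g₂, g₃, g₄] = ![g₁, g₂, g₃ * g₄] := by
    ext i; fin_cases i <;> rfl
  have e4 : Fin.contractNth 3 (· * ·) ![g₁, g₂, g₃, g₄] = ![g₁, g₂, g₃] := by
    ext i; fin_cases i <;> rfl
  rw [e0, e1, e2, e3, e4]
  simp [pow_succ, sub_eq_add_neg, add_assoc]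

variable {A}

lemma iCocycles_injective (n : ℕ) : Function.Injective (iCocycles A n) :=
  (ModuleCat.mono_iff_injective _).1 inferInstance

lemma d_iCocycles (n : ℕ) (x : cocycles A n) :
    inhomogeneousCochains.d A n (iCocycles A n x) = 0 := by
  have h := (inhomogeneousCochains A).iCycles_d n (n + 1)
  rw [inhomogeneousCochains.d_def] at h
  exact congr($h x)

lemma iCocycles_cocyclesMap {G' : Type u} [Group G'] {B : Rep.{u} k G'} (f : G' →* G)
    (φ : Rep.res f A ⟶ B) (n : ℕ) (x : cocycles A n) (g : Fin n → G') :
    (iCocycles B n (cocyclesMap f φ n x) : (Fin n → G') → B) g =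
      φ.hom ((iCocycles A n x : (Fin n → G) → A) (f ∘ g)) := by
  have h := HomologicalComplex.cyclesMap_i (cochainsMap f φ) n
  exact congrFun congr($h x) g

/-- Cohomology is the cokernel of the map from cochains to cocycles, so the kernel of `π` consists
of the coboundaries. -/
lemma π_eq_π_iff (n : ℕ) (x y : cocycles A (n + 1)) :
    π A (n + 1) x = π A (n + 1) y ↔ ∃ b : (Fin n → G) → A,
      (iCocycles A (n + 1) x : (Fin (n + 1) → G) → A) - iCocycles A (n + 1) y =
        (inhomogeneousCochains.d A n).hom b := by
  let K := inhomogeneousCochains A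
  let S := ShortComplex.mk (K.toCycles n (n + 1)) (K.homologyπ (n + 1)) (by simp)
  have hS : S.Exact :=
    S.exact_of_g_is_cokernel (K.homologyIsCokernel n (n + 1) (CochainComplex.prev_nat_succ n))
  have hd (b : (Fin n → G) → A) : iCocycles A (n + 1) (K.toCycles n (n + 1) b) =
      (inhomogeneousCochains.d A n).hom b := by
    have h := K.toCycles_i n (n + 1)
    rw [inhomogeneousCochains.d_def] at h
    exact congr($h b)
  rw [← sub_eq_zero, ← map_sub]
  constructor
  · intro h
    obtain ⟨b, hb⟩ := (ShortComplex.moduleCat_exact_iff S).1 hS _ h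
    refine ⟨b, ?_⟩
    rw [← hd]
    exact (map_sub (iCocycles A (n + 1)).hom x y).symm.trans congr(iCocycles A (n + 1) $hb.symm)
  · rintro ⟨b, hb⟩
    have h : K.toCycles n (n + 1) b = x - y :=
      iCocycles_injective _ (((hd b).trans hb.symm).trans
        (map_sub (iCocycles A (n + 1)).hom x y).symm)
    rw [← h]
    exact (ShortComplex.moduleCat_zero_apply S b)

end groupCohomology

/-! ## The classification -/

namespace ThreeCocycle

variable {G H G' H' : Type u} [Group G] [AddCommGroup H] [DistribMulAction G H]
  [Group G'] [AddCommGroup H'] [DistribMulAction G' H']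

/-- The function `G³ → H` underlying a 3-cocycle of the complex of inhomogeneous cochains. -/
@[simps]
noncomputable def ofCocycles (x : groupCohomology.cocycles (gModule G H) 3) : ThreeCocycle G H where
  toFun := groupCohomology.iCocycles (gModule G H) 3 x
  cocycle g h k l :=
    (groupCohomology.inhomogeneousCochains_d_three_apply (gModule G H) _ g h k l).symm.trans
      (congrFun (groupCohomology.d_iCocycles 3 x) _)

lemma ofCocycles_surjective : Function.Surjective (ofCocycles (G := G) (H := H)) := fun a => by
  have h : inhomogeneousCochains.d (gModule G H) 3 a.toFun = 0 := by
    funext g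
    have hg : g = ![g 0, g 1, g 2, g 3] := by ext i; fin_cases i <;> rfl
    rw [hg]
    exact (groupCohomology.inhomogeneousCochains_d_three_apply (gModule G H) a.toFun ..).trans
      (a.cocycle ..)
  exact ⟨groupCohomology.cocyclesMk a.toFun h,
    ThreeCocycle.ext (groupCohomology.iCocycles_mk (A := gModule G H) a.toFun h)⟩

/-- Evaluated at `(φ g₁, φ g₂, φ g₃)`, the coboundary equation for the transported cocycle is
`IsCompatible` rearranged. -/
lemma map_π_eq_π_iff (x : groupCohomology.cocycles (gModule G H) 3)
    (x' : groupCohomology.cocycles (gModule G' H') 3) (φ : G ≃* G') (ψ : H ≃+ H')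
    (hψ : ∀ (g : G) (h : H), ψ (g • h) = φ g • ψ h) :
    groupCohomology.map (φ.symm : G' →* G) (Quadruple.moduleHom φ ψ hψ) 3
        (groupCohomology.π _ 3 x) = groupCohomology.π _ 3 x' ↔
      ∃ b, IsCompatible (ofCocycles x) (ofCocycles x') φ ψ b := by
  rw [groupCohomology.π_map_apply, groupCohomology.π_eq_π_iff]
  have aux (b : (Fin 2 → G') → H') (g₁ g₂ g₃ : G) :
      ((groupCohomology.iCocycles (gModule G' H') 3
        (groupCohomology.cocyclesMap (φ.symm : G' →* G) (Quadruple.moduleHom φ ψ hψ) 3 x) :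
          (Fin 3 → G') → H') - groupCohomology.iCocycles (gModule G' H') 3 x')
          ![φ g₁, φ g₂, φ g₃] =
        (inhomogeneousCochains.d (gModule G' H') 2).hom b ![φ g₁, φ g₂, φ g₃] ↔
      b ![φ g₁, φ g₂] + (b ![φ (g₁ * g₂), φ g₃] + ψ ((ofCocycles x).toFun ![g₁, g₂, g₃])) =
        (ofCocycles x').toFun ![φ g₁, φ g₂, φ g₃] +
          (φ g₁ • b ![φ g₂, φ g₃] + b ![φ g₁, φ (g₂ * g₃)]) := by
    have e : (φ.symm : G' →* G) ∘ ![φ g₁, φ g₂, φ g₃] = ![g₁, g₂, g₃] := by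
      ext i; fin_cases i <;> simp
    have h₁ := groupCohomology.iCocycles_cocyclesMap (φ.symm : G' →* G)
      (Quadruple.moduleHom φ ψ hψ) 3 x ![φ g₁, φ g₂, φ g₃]
    rw [e] at h₁
    have h₂ := groupCohomology.inhomogeneousCochains_d_two_apply (gModule G' H') b
      (φ g₁) (φ g₂) (φ g₃)
    rw [← map_mul, ← map_mul] at h₂
    have key (p q r s t u v : H') (hp : p = r) (hq : q = s - t + u - v) :
        p - (ofCocycles x').toFun ![φ g₁, φ g₂, φ g₃] = q ↔
          v + (t + r) = (ofCocycles x').toFun ![φ g₁, φ g₂, φ g₃] + (s + u) := by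
      rw [hp, hq, ← sub_eq_zero, ← sub_eq_zero (b := (ofCocycles x').toFun _ + _)]
      refine Eq.congr ?_ rfl
      abel
    exact key _ _ _ _ _ _ _ h₁ h₂
  constructor
  · rintro ⟨b, hb⟩
    exact ⟨fun g h => b ![φ g, φ h], fun g₁ g₂ g₃ => (aux b g₁ g₂ g₃).1 (congrFun hb _)⟩
  · rintro ⟨b, hb⟩
    refine ⟨fun g => b (φ.symm (g 0)) (φ.symm (g 1)), ?_⟩
    funext g
    obtain ⟨g₁, g₂, g₃, rfl⟩ : ∃ g₁ g₂ g₃, g = ![φ g₁, φ g₂, φ g₃] :=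
      ⟨φ.symm (g 0), φ.symm (g 1), φ.symm (g 2), by ext i; fin_cases i <;> simp⟩
    exact (aux _ g₁ g₂ g₃).2 (by simpa using hb g₁ g₂ g₃)

end ThreeCocycle

open ThreeCocycle

lemma Quadruple.equiv_iff_equivalent_skeletal {Q Q' : Quadruple.{u}}
    {x : groupCohomology.cocycles (gModule Q.G Q.H) 3}
    {x' : groupCohomology.cocycles (gModule Q'.G Q'.H) 3}
    (hx : groupCohomology.π _ 3 x = Q.cls) (hx' : groupCohomology.π _ 3 x' = Q'.cls) :
    Q ≈ Q' ↔ Coherent2Group.skeletal (ofCocycles x) ≈ Coherent2Group.skeletal (ofCocycles x') := by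
  constructor
  · rintro ⟨e⟩
    have h := e.map_cls
    rw [← hx, ← hx', map_π_eq_π_iff] at h
    obtain ⟨b, hb⟩ := h
    exact hb.equivalent e.map_action
  · intro h
    obtain ⟨φ, ψ, b, hψ, hb⟩ := exists_isCompatible_of_equivalent h
    exact ⟨⟨φ, ψ, hψ, by rw [← hx, ← hx', map_π_eq_π_iff]; exact ⟨b, hb⟩⟩⟩

lemma Quadruple.exists_cocycles (Q : Quadruple.{u}) :
    ∃ x : groupCohomology.cocycles (gModule Q.G Q.H) 3, groupCohomology.π _ 3 x = Q.cls :=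
  groupCohomology_induction_on Q.cls fun x => ⟨x, rfl⟩

namespace Coherent2Group

lemma hasQuadruple_iff {C : Coherent2Group.{u}} {Q : Quadruple.{u}} :
    C.HasQuadruple Q ↔ ∃ x : groupCohomology.cocycles (gModule Q.G Q.H) 3,
      groupCohomology.π _ 3 x = Q.cls ∧ skeletal (ofCocycles x) ≈ C :=
  exists_congr fun x => and_congr_right fun _ =>
    ⟨fun ⟨c⟩ => Coordinates.equivalent_skeletal (a := ofCocycles x) c,
      fun h => nonempty_coordinates_of_equivalent (a := ofCocycles x) h⟩

lemma HasQuadruple.equiv_iff {C C' : Coherent2Group.{u}} {Q Q' : Quadruple.{u}}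
    (h : C.HasQuadruple Q) (h' : C'.HasQuadruple Q') : C ≈ C' ↔ Q ≈ Q' := by
  obtain ⟨x, hx, e⟩ := hasQuadruple_iff.1 h
  obtain ⟨x', hx', e'⟩ := hasQuadruple_iff.1 h'
  rw [Quadruple.equiv_iff_equivalent_skeletal hx hx']
  exact ⟨fun k => Setoid.trans e (Setoid.trans k (Setoid.symm e')),
    fun k => Setoid.trans (Setoid.symm e) (Setoid.trans k e')⟩

/-- Any cocycle representing `Q'.cls` will do, since its skeletal 2-group is equivalent to the one
attached to `Q`. -/
lemma HasQuadruple.of_equiv {C : Coherent2Group.{u}} {Q Q' : Quadruple.{u}}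
    (h : C.HasQuadruple Q) (e : Q ≈ Q') : C.HasQuadruple Q' := by
  obtain ⟨x, hx, k⟩ := hasQuadruple_iff.1 h
  obtain ⟨x', hx'⟩ := Q'.exists_cocycles
  exact hasQuadruple_iff.2 ⟨x', hx',
    Setoid.trans (Setoid.symm ((Quadruple.equiv_iff_equivalent_skeletal hx hx').1 e)) k⟩

lemma Coordinates.exists_hasQuadruple {C : Coherent2Group.{u}} {G H : Type u} [Group G]
    [AddCommGroup H] [DistribMulAction G H] {a : ThreeCocycle G H} (c : C.Coordinates a.toFun) :
    ∃ Q, C.HasQuadruple Q := by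
  obtain ⟨x, rfl⟩ := ofCocycles_surjective a
  exact ⟨⟨G, H, groupCohomology.π _ 3 x⟩, x, rfl, ⟨c⟩⟩

lemma exists_hasQuadruple (C : Coherent2Group.{u}) : ∃ Q, C.HasQuadruple Q :=
  Coordinates.exists_hasQuadruple (a := ⟨_, C.coordinates.cocycle⟩) C.coordinates

lemma exists_coherent2Group (Q : Quadruple.{u}) : ∃ C : Coherent2Group.{u}, C.HasQuadruple Q := by
  obtain ⟨x, hx⟩ := Q.exists_cocycles
  exact ⟨skeletal (ofCocycles x), hasQuadruple_iff.2 ⟨x, hx, Setoid.refl _⟩⟩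

end Coherent2Group

theorem mainTheorem4 :
    ∃ Φ : Quotient Coherent2Group.setoid.{u} ≃ Quotient Quadruple.setoid.{u},
      ∀ (C : Coherent2Group.{u}) (Q : Quadruple.{u}),
        Φ (Quotient.mk _ C) = Quotient.mk _ Q ↔ C.HasQuadruple Q := by
  -- The choice of quadruple is harmless: `HasQuadruple.equiv_iff` makes `f` well defined and
  -- injective on classes.
  choose f hf using Coherent2Group.exists_hasQuadruple.{u}
  refine ⟨Equiv.ofBijective
    (Quotient.map f fun C C' h => ((hf C).equiv_iff (hf C')).1 h) ⟨?_, ?_⟩, fun C Q => ?_⟩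
  · rintro ⟨C⟩ ⟨C'⟩ h
    exact Quotient.sound (((hf C).equiv_iff (hf C')).2 (Quotient.exact h))
  · rintro ⟨Q⟩
    obtain ⟨C, hC⟩ := Coherent2Group.exists_coherent2Group Q
    exact ⟨Quotient.mk _ C, Quotient.sound (((hf C).equiv_iff hC).1 (Setoid.refl C))⟩
  · exact ⟨fun h => (hf C).of_equiv (Quotient.exact h),
      fun h => Quotient.sound (((hf C).equiv_iff h).1 (Setoid.refl C))⟩
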